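/- Let $A$ be a C*-algebra with closed unit ball $A_{\le 1}$. A degree-$1$ $*$-polynomial over $A$ is a $*$-polynomial $P(\bar x)$ of degree at most $1$ in noncommuting variables $\bar x=(x_k)_{k\in\mathbb N}$ and their adjoints (each polynomial involving only finitely many of them), with complex scalars and with coefficients (parameters) from $A_{\le 1}$. For a compact set $K\subseteq\mathbb R$ and $\varepsilon>0$ let $(K)_\varepsilon=\{t\in\mathbb R : d(t,K)<\varepsilon\}$, with $(\emptyset)_\varepsilon=\emptyset$. The algebra $A$ is called countably degree-$1$ saturated if for every sequence $(P_n)_{n\in\mathbb N}$ of degree-$1$ $*$-polynomials over $A$ and every sequence $(K_n)_{n\in\mathbb N}$ of compact subsets of $\mathbb R$ the following are equivalent: (i) there is a sequence $\bar b=(b_k)_{k\in\mathbb N}$ in $A_{\le 1}$ such that $\|P_n(\bar b)\|\in K_n$ for all $n\in\mathbb N$; (ii) for every $\varepsilon>0$ and every finite $\Delta\subset\mathbb N$ there is a sequence $\bar b=(b_k)_{k\in\mathbb N}$ in $A_{\le 1}$ such that $\|P_n(\bar b)\|\in (K_n)_\varepsilon$ for all $n\in\Delta$. A topological space $X$ has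 the countable chain condition if every collection of pairwise disjoint nonempty open subsets of $X$ is countable. It is sub-Stonean if any two disjoint open $\sigma$-compact subsets of $X$ have disjoint closures, and Rickart if, in addition, those closures are open and compact. Lemma. Let $X$ be an infinite compact Hausdorff space, and suppose that $X$ satisfies one of the following conditions: (1) $X$ has the countable chain condition; (2) $X$ is separable; (3) $X$ is metrizable; (4) $X$ is homeomorphic to a product of two infinite compact Hausdorff spaces; (5) $X$ is not sub-Stonean; (6) $X$ is Rickart. Then the C*-algebra $C(X)$ of continuous complex-valued functions on $X$ is not countably degree-$1$ saturated. -/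

import Mathlib

open Metric Topology

universe u v w

noncomputable section

/-- Formal `*`-polynomials of degree at most `1` over a C*-algebra `A`, in the noncommuting variables
`x₀, x₁, …` and their adjoints, with complex scalars and with parameters from the closed unit ball
of `A`. Up to formal identities, they are the finite complex linear combinations of the terms
`a`, `x`, `x⋆`, `a x`, `x a`, `a x b`, `a x⋆`, `x⋆ a`, `a x⋆ b` with parameters `a`, `b`. -/
inductive DegreeOneStarPoly (A : Type u) [NonUnitalCStarAlgebra A] : Type u
  | const (a : closedBall (0 : A) 1) : DegreeOneStarPoly A
  | var (k : ℕ) : DegreeOneStarPoly A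
  | starVar (k : ℕ) : DegreeOneStarPoly A
  | add (P Q : DegreeOneStarPoly A) : DegreeOneStarPoly A
  | smul (c : ℂ) (P : DegreeOneStarPoly A) : DegreeOneStarPoly A
  | mulLeft (a : closedBall (0 : A) 1) (P : DegreeOneStarPoly A) : DegreeOneStarPoly A
  | mulRight (P : DegreeOneStarPoly A) (a : closedBall (0 : A) 1) : DegreeOneStarPoly A

namespace DegreeOneStarPoly

variable {A : Type u} [NonUnitalCStarAlgebra A]

/-- The value of a `*`-polynomial at a sequence `b` of elements of `A`. -/
def eval (b : ℕ → A) : DegreeOneStarPoly A → A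
  | const a => a
  | var k => b k
  | starVar k => star (b k)
  | add P Q => P.eval b + Q.eval b
  | smul c P => c • P.eval b
  | mulLeft a P => a * P.eval b
  | mulRight P a => P.eval b * a

end DegreeOneStarPoly

/-- Countable degree-`1` saturation of a C*-algebra: for every sequence of conditions
`‖Pₙ(x̄)‖ ∈ Kₙ` with `Pₙ` of degree at most `1` and `Kₙ ⊆ ℝ` compact, the conditions have a common
solution in the closed unit ball if and only if they are approximately finitely satisfiable there.
`Metric.thickening ε K` is the open `ε`-thickening of `K`. -/
def IsCountablyDegreeOneSaturated (A : Type u) [NonUnitalCStarAlgebra A] : Prop :=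
  ∀ (P : ℕ → DegreeOneStarPoly A) (K : ℕ → Set ℝ), (∀ n, IsCompact (K n)) →
    ((∃ b : ℕ → A, (∀ k, ‖b k‖ ≤ 1) ∧ ∀ n, ‖(P n).eval b‖ ∈ K n) ↔
      ∀ ε : ℝ, 0 < ε → ∀ Δ : Finset ℕ,
        ∃ b : ℕ → A, (∀ k, ‖b k‖ ≤ 1) ∧ ∀ n ∈ Δ, ‖(P n).eval b‖ ∈ thickening ε (K n))

/-- Every family of pairwise disjoint nonempty open subsets of `X` is countable. -/
def HasCountableChainCondition (X : Type u) [TopologicalSpace X] : Prop :=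
  ∀ S : Set (Set X), (∀ U ∈ S, IsOpen U ∧ U.Nonempty) → S.PairwiseDisjoint id → S.Countable

/-- Any two disjoint open `σ`-compact sets have disjoint closures. -/
def IsSubStonean (X : Type u) [TopologicalSpace X] : Prop :=
  ∀ U V : Set X, IsOpen U → IsSigmaCompact U → IsOpen V → IsSigmaCompact V → Disjoint U V →
    Disjoint (closure U) (closure V)

/-- Any two disjoint open `σ`-compact sets have disjoint closures, and these closures are open and
compact. -/
def IsRickart (X : Type u) [TopologicalSpace X] : Prop :=
  ∀ U V : Set X, IsOpen U → IsSigmaCompact U → IsOpen V → IsSigmaCompact V → Disjoint U V →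
    Disjoint (closure U) (closure V) ∧
      (IsOpen (closure U) ∧ IsCompact (closure U)) ∧ (IsOpen (closure V) ∧ IsCompact (closure V))

end

/-! Everything rests on two consequences of saturation for `C(X, ℂ)`. First, `X` is sub-Stonean: if
`f`, `g` have disjoint cozero sets, then `f b = f` and `g b = 0` are approximately solvable by
truncating a multiple of `f`, and an exact solution is `1` on one closure and `0` on the other.
Second, closures of open `σ`-compact sets cannot all be open. Take disjoint bumps `fₙ`; if the
closure `C` of the union of their cozero sets were clopen, with indicator `e`, then `‖e b‖ = 1`
together with `fₙ b = 0` for all `n` would be finitely satisfiable by a late bump, while an exact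
solution vanishes on `C`. These settle (5) and (6). Separable or metrizable compact spaces have the
chain condition, which turns sub-Stonean into open closures and so contradicts the second fact. A
product of infinite spaces is never sub-Stonean. -/

/-- A saturated algebra solves countably many conditions `‖aₙ b - cₙ‖ = rₙ` in one variable as soon
as finitely many of them can be solved approximately at a time. -/
theorem IsCountablyDegreeOneSaturated.exists_forall_norm_mul_sub_eq {A : Type u}
    [NonUnitalCStarAlgebra A] (hA : IsCountablyDegreeOneSaturated A) (a c : ℕ → A)
    (ha : ∀ n, ‖a n‖ ≤ 1) (hc : ∀ n, ‖c n‖ ≤ 1) (r : ℕ → ℝ)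
    (h : ∀ ε : ℝ, 0 < ε → ∀ Δ : Finset ℕ,
      ∃ b : A, ‖b‖ ≤ 1 ∧ ∀ n ∈ Δ, |‖a n * b - c n‖ - r n| < ε) :
    ∃ b : A, ‖b‖ ≤ 1 ∧ ∀ n, ‖a n * b - c n‖ = r n := by
  let P : ℕ → DegreeOneStarPoly A := fun n =>
    .add (.mulLeft ⟨a n, by simpa using ha n⟩ (.var 0))
      (.smul (-1) (.const ⟨c n, by simpa using hc n⟩))
  have eval_P : ∀ n (b : ℕ → A), (P n).eval b = a n * b 0 - c n := by
    intro n b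
    simp [P, DegreeOneStarPoly.eval, sub_eq_add_neg]
  obtain ⟨b, hb, hPb⟩ := (hA P (fun n => {r n}) fun n => isCompact_singleton).2 (by
    intro ε hε Δ
    obtain ⟨b, hb, hΔ⟩ := h ε hε Δ
    refine ⟨fun _ => b, fun _ => hb, fun n hn => ?_⟩
    rw [thickening_singleton, mem_ball, Real.dist_eq, eval_P]
    exact hΔ n hn)
  refine ⟨b 0, hb 0, fun n => ?_⟩
  have := hPb n
  rwa [eval_P] at this

/-! ### Cozero sets and the two consequences of saturation -/

section Functions

variable {X : Type u} [TopologicalSpace X]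

/-- A real-valued continuous function, regarded as a complex-valued one. -/
def ContinuousMap.toComplex (f : C(X, ℝ)) : C(X, ℂ) :=
  ⟨fun x => (f x : ℂ), by fun_prop⟩

@[simp]
theorem ContinuousMap.toComplex_apply (f : C(X, ℝ)) (x : X) : f.toComplex x = (f x : ℂ) := rfl

theorem ContinuousMap.norm_toComplex_le_one [CompactSpace X] {f : C(X, ℝ)}
    (hf : ∀ x, f x ∈ Set.Icc (0 : ℝ) 1) : ‖f.toComplex‖ ≤ 1 := by
  refine (ContinuousMap.norm_le _ zero_le_one).2 fun x => ?_
  rw [toComplex_apply, Complex.norm_real, Real.norm_eq_abs, abs_of_nonneg (hf x).1]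
  exact (hf x).2

theorem isSigmaCompact_setOf_pos [CompactSpace X] {f : X → ℝ} (hf : Continuous f) :
    IsSigmaCompact {x | 0 < f x} := by
  have : {x | 0 < f x} = ⋃ n : ℕ, {x | 1 / ((n : ℝ) + 1) ≤ f x} := by
    ext x
    simp only [Set.mem_ofPred_eq, Set.mem_iUnion]
    exact ⟨fun hx => (exists_nat_one_div_lt hx).imp fun n hn => hn.le,
      fun ⟨n, hn⟩ => Nat.one_div_pos_of_nat.trans_le hn⟩
  rw [this]
  exact isSigmaCompact_iUnion_of_isCompact _ fun n => (isClosed_le continuous_const hf).isCompact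

/-- The complement of an open `σ`-compact set is a closed `Gδ`, hence a zero set. -/
theorem exists_continuousMap_setOf_pos_eq [CompactSpace X] [T2Space X] {U : Set X}
    (hU : IsOpen U) (hUσ : IsSigmaCompact U) :
    ∃ f : C(X, ℝ), (∀ x, f x ∈ Set.Icc (0 : ℝ) 1) ∧ {x | 0 < f x} = U := by
  obtain ⟨K, hK, rfl⟩ := hUσ
  have hG : IsGδ (⋃ n, K n)ᶜ := by
    rw [Set.compl_iUnion]
    exact .iInter_of_isOpen fun n => (hK n).isClosed.isOpen_compl
  obtain ⟨f, hf, -, -, hf01⟩ := exists_continuous_one_zero_of_isCompact_of_isGδ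
    hU.isClosed_compl.isCompact hG isClosed_empty (Set.disjoint_empty _)
  refine ⟨1 - f, fun x => ?_, ?_⟩
  · have := hf01 x
    simp only [ContinuousMap.sub_apply, ContinuousMap.one_apply, Set.mem_Icc] at this ⊢
    constructor <;> linarith
  · ext x
    have hx : x ∈ (⋃ n, K n)ᶜ ↔ f x = 1 := by rw [hf]; rfl
    rw [← not_iff_not, ← Set.mem_compl_iff (⋃ n, K n), hx]
    have := (hf01 x).2
    simp only [Set.mem_ofPred_eq, ContinuousMap.sub_apply, ContinuousMap.one_apply, not_lt]
    exact ⟨fun h => by linarith, fun h => by linarith⟩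

theorem exists_continuousMap_one_of_mem_isOpen [CompactSpace X] [T2Space X] {U : Set X}
    (hU : IsOpen U) {x : X} (hx : x ∈ U) :
    ∃ f : C(X, ℝ), (∀ y, f y ∈ Set.Icc (0 : ℝ) 1) ∧ f x = 1 ∧ ∀ y, 0 < f y → y ∈ U := by
  obtain ⟨f, hf0, hf1, hf⟩ := exists_continuous_zero_one_of_isClosed hU.isClosed_compl
    (isClosed_singleton (x := x)) (Set.disjoint_singleton_right.2 fun h => h hx)
  refine ⟨f, hf, hf1 rfl, fun y hy => ?_⟩
  by_contra hyU
  exact hy.ne' (hf0 hyU)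

theorem exists_seq_continuousMap_pairwise_disjoint (X : Type u) [TopologicalSpace X]
    [CompactSpace X] [T2Space X] [Infinite X] :
    ∃ (f : ℕ → C(X, ℝ)) (x : ℕ → X), (∀ n y, f n y ∈ Set.Icc (0 : ℝ) 1) ∧
      (∀ n, f n (x n) = 1) ∧ ∀ n m y, 0 < f n y → 0 < f m y → n = m := by
  obtain ⟨U, hUi, hUo, hd⟩ := exists_seq_infinite_isOpen_pairwise_disjoint X
  choose x hx using fun n => (hUi n).nonempty
  choose f hf01 hfx hfU using fun n => exists_continuousMap_one_of_mem_isOpen (hUo n) (hx n)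
  refine ⟨f, x, hf01, hfx, fun n m y hn hm => ?_⟩
  exact hd.eq (Set.not_disjoint_iff.2 ⟨y, hfU n y hn, hfU m y hm⟩)

theorem IsCountablyDegreeOneSaturated.isSubStonean [CompactSpace X] [T2Space X]
    (h : IsCountablyDegreeOneSaturated C(X, ℂ)) : IsSubStonean X := by
  intro U V hU hUσ hV hVσ hUV
  obtain ⟨f, hf, rfl⟩ := exists_continuousMap_setOf_pos_eq hU hUσ
  obtain ⟨g, hg, rfl⟩ := exists_continuousMap_setOf_pos_eq hV hVσ
  obtain ⟨b, -, hb⟩ := h.exists_forall_norm_mul_sub_eq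
    (fun n => if n = 0 then f.toComplex else g.toComplex)
    (fun n => if n = 0 then f.toComplex else 0)
    (fun n => by
      split_ifs
      exacts [ContinuousMap.norm_toComplex_le_one hf, ContinuousMap.norm_toComplex_le_one hg])
    (fun n => by
      split_ifs
      exacts [ContinuousMap.norm_toComplex_le_one hf, by simp])
    (fun _ => 0) (by
      intro ε hε Δ
      -- The error `f (1 - k)` is zero where `f ≥ ε / 2` and at most `ε / 2` elsewhere; where `g >
      -- 0`, `f` and therefore `k` vanish.
      let k : C(X, ℝ) := ⟨fun x => min 1 (f x / (ε / 2)), by fun_prop⟩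
      have hk : ∀ x, k x ∈ Set.Icc (0 : ℝ) 1 := fun x =>
        ⟨le_min zero_le_one (div_nonneg (hf x).1 (by positivity)), min_le_left _ _⟩
      refine ⟨k.toComplex, ContinuousMap.norm_toComplex_le_one hk, fun n _ => ?_⟩
      rw [sub_zero, abs_norm]
      refine lt_of_le_of_lt ?_ (half_lt_self hε)
      refine (ContinuousMap.norm_le _ (by positivity)).2 fun x => ?_
      split_ifs with hn
      · have : (f.toComplex * k.toComplex - f.toComplex) x = ((f x * k x - f x : ℝ) : ℂ) := by
          simp
        rw [this, Complex.norm_real, Real.norm_eq_abs]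
        have h0 := (hf x).1
        have h1 := hk x
        rcases le_total (ε / 2) (f x) with hx | hx
        · have : k x = 1 := min_eq_left ((one_le_div (by positivity)).2 hx)
          rw [this, mul_one, sub_self, abs_zero]
          positivity
        · rw [abs_le]
          constructor <;> nlinarith [h1.1, h1.2]
      · have : (g.toComplex * k.toComplex - 0) x = ((g x * k x : ℝ) : ℂ) := by simp
        rw [this]
        have hz : g x * k x = 0 := by
          by_cases hx : 0 < g x
          · have hfx : f x = 0 := le_antisymm
              (not_lt.1 fun h' => Set.disjoint_left.1 hUV h' hx) (hf x).1
            have : k x = min 1 (f x / (ε / 2)) := rfl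
            rw [this, hfx]
            simp
          · rw [le_antisymm (not_lt.1 hx) (hg x).1, zero_mul]
        rw [hz]
        simpa using (half_pos hε).le)
  have hb0 : f.toComplex * b - f.toComplex = 0 := by simpa using hb 0
  have hb1 : g.toComplex * b = 0 := by simpa using hb 1
  have hU1 : closure {x | 0 < f x} ⊆ {x | b x = 1} := by
    refine closure_minimal (fun x hx => ?_) (isClosed_eq b.continuous continuous_const)
    have hx0 : (f x : ℂ) ≠ 0 := by exact_mod_cast (show 0 < f x from hx).ne'
    have := DFunLike.congr_fun hb0 x
    simp only [ContinuousMap.sub_apply, ContinuousMap.mul_apply, ContinuousMap.toComplex_apply,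
      ContinuousMap.zero_apply, sub_eq_zero] at this
    exact mul_left_cancel₀ hx0 (by rw [this, mul_one])
  have hV0 : closure {x | 0 < g x} ⊆ {x | b x = 0} := by
    refine closure_minimal (fun x hx => ?_) (isClosed_eq b.continuous continuous_const)
    have hx0 : (g x : ℂ) ≠ 0 := by exact_mod_cast (show 0 < g x from hx).ne'
    have := DFunLike.congr_fun hb1 x
    simp only [ContinuousMap.mul_apply, ContinuousMap.toComplex_apply,
      ContinuousMap.zero_apply] at this
    exact (mul_eq_zero.1 this).resolve_left hx0
  refine Set.disjoint_left.2 fun x hxU hxV => ?_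
  exact one_ne_zero ((hU1 hxU).symm.trans (hV0 hxV))

theorem not_isCountablyDegreeOneSaturated_of_isOpen_closure [CompactSpace X] [T2Space X]
    [Infinite X] (hX : ∀ U : Set X, IsOpen U → IsSigmaCompact U → IsOpen (closure U)) :
    ¬ IsCountablyDegreeOneSaturated C(X, ℂ) := by
  intro h
  obtain ⟨f, x, hf, hfx, hd⟩ := exists_seq_continuousMap_pairwise_disjoint X
  set C : Set X := closure (⋃ n, {y | 0 < f n y}) with hC
  have hfC : ∀ n y, 0 < f n y → y ∈ C := fun n y hy =>
    subset_closure (Set.mem_iUnion.2 ⟨n, hy⟩)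
  have hCo : IsOpen C := hX _
    (isOpen_iUnion fun n => isOpen_lt continuous_const (f n).continuous)
    (isSigmaCompact_iUnion _ fun n => isSigmaCompact_setOf_pos (f n).continuous)
  -- Since `C` is clopen, Urysohn's lemma for `Cᶜ` and `C` yields the indicator of `C`.
  obtain ⟨e, he0, he1, he⟩ := exists_continuous_zero_one_of_isClosed hCo.isClosed_compl
    (isClosed_closure (s := ⋃ n, {y | 0 < f n y})) disjoint_compl_left
  obtain ⟨b, -, hb⟩ := h.exists_forall_norm_mul_sub_eq
    (fun n => n.casesOn e.toComplex fun m => (f m).toComplex) (fun _ => 0)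
    (fun n => by
      cases n
      exacts [ContinuousMap.norm_toComplex_le_one he, ContinuousMap.norm_toComplex_le_one (hf _)])
    (fun n => by simp) (fun n => if n = 0 then 1 else 0) (by
      intro ε hε Δ
      -- The condition for `f m` has index `m + 1 ≤ N`, so `m < N` and `f N` is disjoint from every
      -- bump occurring in `Δ`.
      obtain ⟨N, hN⟩ := Δ.bddAbove
      refine ⟨(f N).toComplex, ContinuousMap.norm_toComplex_le_one (hf N), fun n hn => ?_⟩
      rcases n with _ | m
      · have : ‖e.toComplex * (f N).toComplex‖ = 1 := by
          refine le_antisymm ?_ ?_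
          · exact (norm_mul_le _ _).trans (mul_le_one₀ (ContinuousMap.norm_toComplex_le_one he)
              (norm_nonneg _) (ContinuousMap.norm_toComplex_le_one (hf N)))
          · have hx : x N ∈ C := hfC N _ (by rw [hfx]; exact one_pos)
            have := (e.toComplex * (f N).toComplex).norm_coe_le_norm (x N)
            simpa [hfx, show e (x N) = 1 from he1 hx] using this
        simpa [this] using hε
      · have : (f m).toComplex * (f N).toComplex = 0 := by
          ext y
          have hz : f m y = 0 ∨ f N y = 0 := by
            by_contra! hne
            have := hd m N y (lt_of_le_of_ne (hf m y).1 hne.1.symm)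
              (lt_of_le_of_ne (hf N y).1 hne.2.symm)
            have := hN hn
            omega
          simpa using hz
        simpa [this] using hε)
  have hbf : ∀ n, (f n).toComplex * b = 0 := fun n => by simpa using hb (n + 1)
  have hbC : C ⊆ {y | b y = 0} := by
    refine closure_minimal (Set.iUnion_subset fun n y hy => ?_)
      (isClosed_eq b.continuous continuous_const)
    have hy0 : (f n y : ℂ) ≠ 0 := by exact_mod_cast (show 0 < f n y from hy).ne'
    have := DFunLike.congr_fun (hbf n) y
    simp only [ContinuousMap.mul_apply, ContinuousMap.toComplex_apply,
      ContinuousMap.zero_apply] at this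
    exact (mul_eq_zero.1 this).resolve_left hy0
  have heb : e.toComplex * b = 0 := by
    ext y
    by_cases hy : y ∈ C
    · simp [show b y = 0 from hbC hy]
    · simp [show e y = 0 from he0 hy]
  simpa [heb] using hb 0

end Functions

/-! ### Topology of the listed classes of spaces -/

section Spaces

theorem HasCountableChainCondition.of_separableSpace (X : Type u) [TopologicalSpace X]
    [TopologicalSpace.SeparableSpace X] : HasCountableChainCondition X := fun _ hS hd =>
  hd.countable_of_isOpen (fun U hU => (hS U hU).1) fun U hU => (hS U hU).2

/-- Under the countable chain condition every open set has a dense open `σ`-compact subset. -/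
theorem HasCountableChainCondition.exists_isSigmaCompact_dense {X : Type u} [TopologicalSpace X]
    [CompactSpace X] [T2Space X] (hX : HasCountableChainCondition X) {V : Set X}
    (hV : IsOpen V) :
    ∃ W ⊆ V, IsOpen W ∧ IsSigmaCompact W ∧ V ⊆ closure W := by
  -- A maximal disjoint family of open `σ`-compact subsets of `V` is countable, so its union is
  -- still `σ`-compact.
  let F : Set (Set (Set X)) := {S | (∀ U ∈ S, (IsOpen U ∧ U.Nonempty) ∧ IsSigmaCompact U ∧ U ⊆ V) ∧
    S.PairwiseDisjoint id}
  obtain ⟨S, hS⟩ := zorn_subset F (by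
    intro c hcF hc
    refine ⟨⋃₀ c, ⟨?_, ?_⟩, fun s hs => Set.subset_sUnion_of_mem hs⟩
    · rintro U ⟨s, hs, hU⟩
      exact (hcF hs).1 U hU
    · exact (Set.pairwiseDisjoint_sUnion hc.directedOn).2 fun s hs => (hcF hs).2)
  have hSF := hS.prop
  have hcount : S.Countable := hX S (fun U hU => (hSF.1 U hU).1) hSF.2
  refine ⟨⋃₀ S, Set.sUnion_subset fun U hU => (hSF.1 U hU).2.2,
    isOpen_sUnion fun U hU => (hSF.1 U hU).1.1,
    isSigmaCompact_sUnion S hcount fun U => (hSF.1 U U.2).2.1, fun x hxV => ?_⟩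
  by_contra hx
  -- A point of `V` missed by the closure has a cozero neighbourhood that could be added to `S`,
  -- against maximality.
  obtain ⟨f, -, hfx, hfU⟩ := exists_continuousMap_one_of_mem_isOpen
    (hV.inter (isClosed_closure (s := ⋃₀ S)).isOpen_compl) ⟨hxV, hx⟩
  have hxf : 0 < f x := by rw [hfx]; exact one_pos
  have hins : insert {y | 0 < f y} S ∈ F := by
    refine ⟨?_, (Set.pairwiseDisjoint_insert).2 ⟨hSF.2, fun U hU _ => ?_⟩⟩
    · rintro U (rfl | hU)
      · exact ⟨⟨isOpen_lt continuous_const f.continuous, x, hxf⟩,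
          isSigmaCompact_setOf_pos f.continuous, fun y hy => (hfU y hy).1⟩
      · exact hSF.1 U hU
    · exact Set.disjoint_left.2 fun y hy hyU => (hfU y hy).2 (subset_closure ⟨U, hU, hyU⟩)
  have hmem : {y | 0 < f y} ∈ S := hS.le_of_ge hins (Set.subset_insert _ _) (Set.mem_insert _ _)
  exact hx (subset_closure ⟨_, hmem, hxf⟩)

/-- An open `σ`-compact `W` dense in the exterior of `U` has closure disjoint from that of `U`, so
the two closures are complementary. -/
theorem HasCountableChainCondition.isOpen_closure {X : Type u} [TopologicalSpace X]
    [CompactSpace X] [T2Space X] (hX : HasCountableChainCondition X) (hS : IsSubStonean X)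
    {U : Set X} (hU : IsOpen U) (hUσ : IsSigmaCompact U) : IsOpen (closure U) := by
  obtain ⟨W, hWV, hWo, hWσ, hVW⟩ :=
    hX.exists_isSigmaCompact_dense (isClosed_closure (s := U)).isOpen_compl
  have hd := hS U W hU hUσ hWo hWσ
    (Set.disjoint_left.2 fun x hxU hxW => hWV hxW (subset_closure hxU))
  have : closure U = (closure W)ᶜ :=
    Set.Subset.antisymm hd.subset_compl_right (Set.compl_subset_comm.1 hVW)
  rw [this]
  exact isClosed_closure.isOpen_compl

theorem IsSubStonean.of_homeomorph {X : Type u} {Y : Type v} [TopologicalSpace X]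
    [TopologicalSpace Y] (hX : IsSubStonean X) (e : X ≃ₜ Y) : IsSubStonean Y := by
  intro U V hU hUσ hV hVσ hUV
  have := hX (e.symm '' U) (e.symm '' V) (e.symm.isOpenMap U hU) (hUσ.image e.symm.continuous)
    (e.symm.isOpenMap V hV) (hVσ.image e.symm.continuous)
    ((Set.disjoint_image_iff e.symm.injective).2 hUV)
  rw [← e.symm.image_closure, ← e.symm.image_closure] at this
  exact (Set.disjoint_image_iff e.symm.injective).1 this

/-- Given disjoint nonempty open sets `Uₙ` of `Y` and `Vₙ` of `Z`, the closures of the unions of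
the diagonal and of the off-diagonal rectangles `Uₙ ×ˢ Vₘ` meet. -/
theorem not_isSubStonean_prod (Y : Type v) (Z : Type w) [TopologicalSpace Y] [TopologicalSpace Z]
    [CompactSpace Y] [T2Space Y] [Infinite Y] [CompactSpace Z] [T2Space Z] [Infinite Z] :
    ¬ IsSubStonean (Y × Z) := by
  intro h
  obtain ⟨f, y, hf, hfy, hfd⟩ := exists_seq_continuousMap_pairwise_disjoint Y
  obtain ⟨g, z, hg, hgz, hgd⟩ := exists_seq_continuousMap_pairwise_disjoint Z
  -- As cozero sets, these rectangles are both open and `σ`-compact.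
  let R : ℕ × ℕ → Set (Y × Z) := fun p => {q | 0 < f p.1 q.1 * g p.2 q.2}
  have hcont : ∀ p : ℕ × ℕ, Continuous fun q : Y × Z => f p.1 q.1 * g p.2 q.2 := fun p => by
    fun_prop
  have hRo : ∀ p, IsOpen (R p) := fun p => isOpen_lt continuous_const (hcont p)
  have hRσ : ∀ p, IsSigmaCompact (R p) := fun p => isSigmaCompact_setOf_pos (hcont p)
  have hmem : ∀ n m, (y n, z m) ∈ R (n, m) := fun n m => by
    simp [R, hfy, hgz]
  have hRd : ∀ p p' q, q ∈ R p → q ∈ R p' → p = p' := by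
    intro p p' q hp hp'
    have hpos : ∀ p, q ∈ R p → 0 < f p.1 q.1 ∧ 0 < g p.2 q.2 := fun p hp =>
      ⟨pos_of_mul_pos_left hp (hg _ _).1, pos_of_mul_pos_right hp (hf _ _).1⟩
    exact Prod.ext (hfd _ _ _ (hpos p hp).1 (hpos p' hp').1)
      (hgd _ _ _ (hpos p hp).2 (hpos p' hp').2)
  have hd := h (⋃ n : ℕ, R (n, n)) (⋃ p : {p : ℕ × ℕ // p.1 ≠ p.2}, R p)
    (isOpen_iUnion fun n => hRo _) (isSigmaCompact_iUnion _ fun n => hRσ _)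
    (isOpen_iUnion fun p => hRo _) (isSigmaCompact_iUnion _ fun p => hRσ _)
    (Set.disjoint_left.2 fun q hq hq' => by
      obtain ⟨n, hn⟩ := Set.mem_iUnion.1 hq
      obtain ⟨p, hp⟩ := Set.mem_iUnion.1 hq'
      have hnp := hRd _ _ q hn hp
      exact p.2 (by rw [← hnp]))
  -- A cluster point of the diagonal points lies in both closures: any box around it contains two of
  -- them with indices `n < m`, hence also the off-diagonal point `(y n, z m)`.
  obtain ⟨a, ha⟩ := exists_clusterPt_of_compactSpace
    (Filter.map (fun n => (y n, z n)) Filter.atTop)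
  have hfreq : ∀ s ∈ 𝓝 a, ∃ᶠ n in Filter.atTop, (y n, z n) ∈ s := mapClusterPt_iff_frequently.1 ha
  refine Set.disjoint_left.1 hd (?_ : a ∈ _) ?_
  · refine mem_closure_iff_nhds.2 fun s hs => ?_
    obtain ⟨n, hn⟩ := (hfreq s hs).exists
    exact ⟨_, hn, Set.mem_iUnion.2 ⟨n, hmem n n⟩⟩
  · refine mem_closure_iff_nhds.2 fun s hs => ?_
    obtain ⟨u, hu, v, hv, huv⟩ := mem_nhds_prod_iff.1 hs
    have huv' := hfreq _ (prod_mem_nhds hu hv)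
    obtain ⟨n, hn⟩ := huv'.exists
    obtain ⟨m, hnm, hm⟩ := Filter.frequently_atTop.1 huv' (n + 1)
    exact ⟨(y n, z m), huv ⟨hn.1, hm.2⟩,
      Set.mem_iUnion.2 ⟨⟨(n, m), by simp only; omega⟩, hmem n m⟩⟩

end Spaces

theorem HasCountableChainCondition.not_isCountablyDegreeOneSaturated {X : Type u}
    [TopologicalSpace X] [CompactSpace X] [T2Space X] [Infinite X]
    (hX : HasCountableChainCondition X) : ¬ IsCountablyDegreeOneSaturated C(X, ℂ) := fun h =>
  not_isCountablyDegreeOneSaturated_of_isOpen_closure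
    (fun _ hU hUσ => hX.isOpen_closure h.isSubStonean hU hUσ) h

theorem mainTheorem7 (X : Type u) [TopologicalSpace X] [CompactSpace X] [T2Space X] [Infinite X]
    (hX : HasCountableChainCondition X ∨
      TopologicalSpace.SeparableSpace X ∨
      TopologicalSpace.MetrizableSpace X ∨
      (∃ (Y : Type v) (Z : Type w) (_ : TopologicalSpace Y) (_ : TopologicalSpace Z),
        CompactSpace Y ∧ T2Space Y ∧ Infinite Y ∧ CompactSpace Z ∧ T2Space Z ∧ Infinite Z ∧
          Nonempty (X ≃ₜ Y × Z)) ∨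
      ¬ IsSubStonean X ∨
      IsRickart X) :
    ¬ IsCountablyDegreeOneSaturated C(X, ℂ) := by
  rcases hX with hX | hX | hX | ⟨Y, Z, _, _, _, _, _, _, _, _, ⟨e⟩⟩ | hX | hX
  · exact hX.not_isCountablyDegreeOneSaturated
  · exact (HasCountableChainCondition.of_separableSpace X).not_isCountablyDegreeOneSaturated
  · let := TopologicalSpace.metrizableSpaceMetric X
    exact (HasCountableChainCondition.of_separableSpace X).not_isCountablyDegreeOneSaturated
  · exact fun h => not_isSubStonean_prod Y Z (h.isSubStonean.of_homeomorph e)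
  · exact fun h => hX h.isSubStonean
  · exact not_isCountablyDegreeOneSaturated_of_isOpen_closure fun U hU hUσ =>
      (hX U ∅ hU hUσ isOpen_empty isSigmaCompact_empty (Set.disjoint_empty U)).2.1.1
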